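/- Let $h_0=1.26$. A packing is a set $V\subset\mathbb{R}^3$ such that $\|v-w\|<2$ implies $v=w$ for all $v,w\in V$. Let $\mathcal V$ be the set of packings $V$ with exactly $12$ points, all on the sphere of radius $2$ centered at the origin, such that for all $u,v\in V$ we have $u=v$, $\|u-v\|=2$, or $\|u-v\|\ge 2h_0$. For a packing $V$ let $E_2(V)$ be the set of pairs $\{u,v\}\subset V$ with $\|u-v\|=2$ (the contact edges), and let $E^+(V)$ be the set of pairs $\{u,v\}\subset V$ with $2\le\|u-v\|<\sqrt8$. For a finite set $S\subset\mathbb{R}^3$ let $C(S)=\{\sum_{v\in S}t_v v : t_v\ge 0\}$, so that $C(\varnothing)=\{0\}$. A pair $(V,E)$, with $V\subset\mathbb{R}^3$ and $E$ a set of unordered pairs of distinct elements of $V$, is a fan if $V$ is finite and nonempty; $0\notin V$; $\{0,v,w\}$ is not collinear whenever $\{v,w\}\in E$; and $C(\varepsilon)\cap C(\varepsilon')=C(\varepsilon\cap\varepsilon')$ for all $\varepsilon,\varepsilon'\in E\cup\{\{v\}:v\in V\}$. A graph is biconnected if it is connected and has no vertex whose deletion increases the number of connected components. Let $\mathcal V'$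 be the set of those $V\in\mathcal V$ for which $(V,E^+(V))$ is a fan and the graph $(V,E^+(V))$ is biconnected. Lemma. For every $V\in\mathcal V$ there are $V'\in\mathcal V'$ and a bijection $\phi:V'\to V$ that induces an isomorphism of contact graphs $(V',E_2(V'))\cong(V,E_2(V))$. Moreover, $V'$ can be reached from $V$ by a deformation that creates no new short edges: there are continuous maps $q_v:[0,1]\to\mathbb{R}^3$ $(v\in V)$ with $q_v(0)=v$ and $q_v(1)=\phi^{-1}(v)$ such that for every $t\in[0,1]$ the points $q_v(t)$ are pairwise distinct, $\{q_v(t):v\in V\}\in\mathcal V$, and for all $u,v\in V$: $\|q_u(t)-q_v(t)\|=2$ if and only if $\|u-v\|=2$, and $\|q_u(t)-q_v(t)\|\le 2h_0$ implies $\|u-v\|\le 2h_0$. -/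

import Mathlib

noncomputable section

namespace KissingTwelve

/-- Euclidean three-space. -/
abbrev R3 : Type := EuclideanSpace ℝ (Fin 3)

/-- The truncation parameter `1.26`. -/
def h0 : ℝ := 1.26

/-- A packing of unit balls, identified with its set of centers. -/
def IsPacking (V : Set R3) : Prop :=
  ∀ v ∈ V, ∀ w ∈ V, dist v w < 2 → v = w

/-- The class `𝒱`: packings of twelve points on the sphere of radius `2` about the origin in which
two different points have distance exactly `2` or at least `2 * h0`. -/
def ClassV : Set (Set R3) :=
  {V | IsPacking V ∧ V.encard = 12 ∧ V ⊆ Metric.sphere 0 2 ∧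
    ∀ u ∈ V, ∀ v ∈ V, u = v ∨ dist u v = 2 ∨ 2 * h0 ≤ dist u v}

open scoped Classical in
/-- The contact edges `E₂(V)`. -/
def E2 (V : Set R3) : Set (Finset R3) :=
  {e | ∃ u ∈ V, ∃ v ∈ V, dist u v = 2 ∧ e = {u, v}}

open scoped Classical in
/-- The set `E⁺(V)` of pairs of points of `V` with distance in `[2, √8)`. -/
def EPlus (V : Set R3) : Set (Finset R3) :=
  {e | ∃ u ∈ V, ∃ v ∈ V, 2 ≤ dist u v ∧ dist u v < √8 ∧ e = {u, v}}

/-- `aff₊(S, S')`: the affine combinations of `S` and `S'` (one coefficient for each listed point of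
`S` and one for each listed point of `S'`) whose coefficients on `S'` are nonnegative. -/
def affPlus (S S' : Finset R3) : Set R3 :=
  {x | ∃ s t : R3 → ℝ, ∑ v ∈ S, s v + ∑ v ∈ S', t v = 1 ∧ (∀ v ∈ S', 0 ≤ t v) ∧
    x = ∑ v ∈ S, s v • v + ∑ v ∈ S', t v • v}

/-- `C(S) = aff₊({0}, S)`, the cone spanned by the finite set `S`. -/
def cone (S : Finset R3) : Set R3 := affPlus {0} S

open scoped Classical in
/-- `(V, E)`, where `E` is a set of unordered pairs of distinct points of `V`, is a fan. -/
structure IsFan (V : Set R3) (E : Set (Finset R3)) : Prop where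
  pairs : ∀ e ∈ E, e.card = 2 ∧ (e : Set R3) ⊆ V
  finite : V.Finite
  nonempty : V.Nonempty
  origin : (0 : R3) ∉ V
  nonparallel : ∀ v w : R3, ({v, w} : Finset R3) ∈ E → ¬ Collinear ℝ ({0, v, w} : Set R3)
  intersection : ∀ e ∈ E ∪ {s | ∃ v ∈ V, s = {v}}, ∀ e' ∈ E ∪ {s | ∃ v ∈ V, s = {v}},
    cone e ∩ cone e' = cone (e ∩ e')

open scoped Classical in
/-- The graph with vertex set `V` and edge set `E`. -/
def graphOf (V : Set R3) (E : Set (Finset R3)) : SimpleGraph V where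
  Adj u v := u ≠ v ∧ ({(u : R3), (v : R3)} : Finset R3) ∈ E
  symm := ⟨fun u v h => ⟨h.1.symm, by rw [Finset.pair_comm]; exact h.2⟩⟩
  loopless := ⟨fun _ h => h.1 rfl⟩

/-- A vertex whose deletion increases the number of connected components. -/
def IsArticulation {α : Type*} (G : SimpleGraph α) (v : α) : Prop :=
  ENat.card G.ConnectedComponent < ENat.card (G.induce ({v}ᶜ : Set α)).ConnectedComponent

/-- A graph is biconnected if it is connected and has no articulation vertex. -/
def IsBiconnected {α : Type*} (G : SimpleGraph α) : Prop :=
  G.Connected ∧ ∀ v, ¬ IsArticulation G v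

/-- The class `𝒱'`: those `V ∈ 𝒱` for which `(V, E⁺(V))` is a biconnected fan. -/
def ClassV' : Set (Set R3) :=
  {V | V ∈ ClassV ∧ IsFan V (EPlus V) ∧ IsBiconnected (graphOf V (EPlus V))}

/-- The placements `q` of the points of `V` as distinct points of a configuration in `𝒱`, with
the same contacts as in `V` and with no new pair at distance at most `2 * h0`. -/
def goodPlacements (V : Set R3) : Set (V → R3) :=
  {q | Function.Injective q ∧ Set.range q ∈ ClassV ∧
    (∀ u v : V, dist (q u) (q v) = 2 ↔ dist u v = 2) ∧
    ∀ u v : V, dist (q u) (q v) ≤ 2 * h0 → dist u v ≤ 2 * h0}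

end KissingTwelve

end

/-!
The points of a configuration have norm `2`, so `dist u v < √8` means that `u` and `v` enclose an
acute angle, and `2 ≤ dist u v` means `⟪u, v⟫ ≤ 2`.

The edges shorter than `√8` always form a fan (`isFan_EPlus`). Suppose that a point of two cones is
written in both ways and the common part of the two representations is removed. The rest is a vector
`y` with representations of weights `S` and `T` on disjoint sets of vertices, so `‖y‖ ^ 2 ≤ 2 * S * T`.
Since the edges subtend acute angles, also `‖y‖ ^ 2 > 2 * S ^ 2` and `‖y‖ ^ 2 > 2 * T ^ 2` unless the
weights vanish; hence they vanish.

Biconnectedness is reached by maximality. Among the placements that can be reached from `V` through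
good placements, take one with the largest number of pairs at distance less than `√8`. If its graph
is not biconnected, it splits into parts `A` and `B` without edges between them, possibly after the
deletion of a vertex `v` adjacent to both. Turn `A` rigidly about an axis: the axis through `v`, or,
without `v`, one perpendicular to a point of `A` and a point of `B`. Some point of `A` and some point
of `B` then lie at similar latitudes, so the rotation would eventually bring them close together.
Stop it at the first time that a pair in `A × B` has distance `2.6`. As `2 * h0 < 2.6 < √8`, no
contact and no pair at distance at most `2 * h0` has been created, the distances outside `A × B` are
unchanged, and a new pair shorter than `√8` has appeared (`exists_joinedIn_of_separated`). This
contradicts the choice of the placement (`exists_placement_biconnected`).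
-/

noncomputable section

namespace KissingTwelve

open scoped InnerProductSpace

/-! ### Distances and inner products in a configuration -/

lemma inner_eq_of_norm_eq_two {x y : R3} (hx : ‖x‖ = 2) (hy : ‖y‖ = 2) :
    ⟪x, y⟫_ℝ = (8 - dist x y ^ 2) / 2 := by
  have h := norm_sub_sq_real x y
  rw [hx, hy, ← dist_eq_norm] at h
  linarith

lemma norm_eq_two_of_mem {W : Set R3} (hW : W ∈ ClassV) {x : R3} (hx : x ∈ W) : ‖x‖ = 2 := by
  simpa using hW.2.2.1 hx

lemma two_le_dist {W : Set R3} (hW : W ∈ ClassV) {x y : R3} (hx : x ∈ W) (hy : y ∈ W)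
    (hxy : x ≠ y) : 2 ≤ dist x y :=
  not_lt.1 fun h => hxy (hW.1 x hx y hy h)

lemma inner_le_two {W : Set R3} (hW : W ∈ ClassV) {x y : R3} (hx : x ∈ W) (hy : y ∈ W)
    (hxy : x ≠ y) : ⟪x, y⟫_ℝ ≤ 2 := by
  rw [inner_eq_of_norm_eq_two (norm_eq_two_of_mem hW hx) (norm_eq_two_of_mem hW hy)]
  nlinarith [two_le_dist hW hx hy hxy]

lemma inner_pos_iff_dist_lt {W : Set R3} (hW : W ∈ ClassV) {x y : R3} (hx : x ∈ W)
    (hy : y ∈ W) : 0 < ⟪x, y⟫_ℝ ↔ dist x y < √8 := by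
  rw [inner_eq_of_norm_eq_two (norm_eq_two_of_mem hW hx) (norm_eq_two_of_mem hW hy),
    Real.lt_sqrt dist_nonneg]
  constructor <;> intro h <;> linarith

open scoped Classical in
lemma pair_mem_EPlus_iff {W : Set R3} (hW : W ∈ ClassV) {x y : R3} (hx : x ∈ W) (hy : y ∈ W)
    (hxy : x ≠ y) : ({x, y} : Finset R3) ∈ EPlus W ↔ dist x y < √8 := by
  constructor
  · rintro ⟨u, -, v, -, -, huv, h⟩
    have h' : s(x, y) = s(u, v) := by
      have := congrArg (fun s : Finset R3 => (s : Set R3)) h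
      simp only [Finset.coe_insert, Finset.coe_singleton] at this
      rcases Set.pair_eq_pair_iff.1 this with ⟨rfl, rfl⟩ | ⟨rfl, rfl⟩
      · rfl
      · exact Sym2.eq_swap
    rcases Sym2.eq_iff.1 h' with ⟨rfl, rfl⟩ | ⟨rfl, rfl⟩
    · exact huv
    · rwa [dist_comm]
  · exact fun h => ⟨x, hx, y, hy, two_le_dist hW hx hy hxy, h, rfl⟩

lemma graphOf_EPlus_adj_iff {W : Set R3} (hW : W ∈ ClassV) (x y : W) :
    (graphOf W (EPlus W)).Adj x y ↔ x ≠ y ∧ dist (x : R3) y < √8 := by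
  refine and_congr_right fun h => pair_mem_EPlus_iff hW x.2 y.2 fun h' => h (Subtype.ext h')

lemma graphOf_E2_adj_iff (W : Set R3) (x y : W) :
    (graphOf W (E2 W)).Adj x y ↔ dist (x : R3) y = 2 := by
  classical
  constructor
  · rintro ⟨-, u, -, v, -, huv, h⟩
    have := congrArg (fun s : Finset R3 => (s : Set R3)) h
    simp only [Finset.coe_insert, Finset.coe_singleton] at this
    rcases Set.pair_eq_pair_iff.1 this with ⟨h1, h2⟩ | ⟨h1, h2⟩
    · rw [h1, h2, huv]
    · rw [h1, h2, dist_comm, huv]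
  · intro h
    refine ⟨?_, x, x.2, y, y.2, h, ?_⟩
    · rintro rfl
      simp at h
    · congr

/-! ### Cones over short edges -/

/-- The coefficient of the apex `0` absorbs the condition that the coefficients add up to `1`. -/
lemma mem_cone_iff (S : Finset R3) (x : R3) :
    x ∈ cone S ↔ ∃ t : R3 → ℝ, (∀ v ∈ S, 0 ≤ t v) ∧ x = ∑ v ∈ S, t v • v := by
  constructor
  · rintro ⟨s, t, -, ht, hx⟩
    exact ⟨t, ht, by simpa using hx⟩
  · rintro ⟨t, ht, hx⟩
    exact ⟨fun _ => 1 - ∑ v ∈ S, t v, t, by simp, ht, by simpa using hx⟩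

lemma cone_mono {S T : Finset R3} (h : S ⊆ T) : cone S ⊆ cone T := by
  classical
  intro x hx
  obtain ⟨t, ht, rfl⟩ := (mem_cone_iff S x).1 hx
  refine (mem_cone_iff T _).2 ⟨fun v => if v ∈ S then t v else 0, fun v _ => ?_, ?_⟩
  · dsimp only
    split_ifs with hv
    exacts [ht v hv, le_rfl]
  · simp [ite_smul, Finset.inter_eq_right.2 h]

/-- A nonzero point of the cone over one or two vectors of norm `2` at an acute angle is longer than
`√2` times its total weight. -/
lemma two_mul_sum_sq_lt_norm_sq {e : Finset R3} (hcard : e.card ≤ 2) (hnorm : ∀ v ∈ e, ‖v‖ = 2)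
    (hpos : ∀ v ∈ e, ∀ w ∈ e, 0 < ⟪v, w⟫_ℝ) {s : R3 → ℝ} (hs : ∀ v ∈ e, 0 ≤ s v)
    (hsum : 0 < ∑ v ∈ e, s v) :
    2 * (∑ v ∈ e, s v) ^ 2 < ‖∑ v ∈ e, s v • v‖ ^ 2 := by
  classical
  interval_cases h : e.card
  · rw [Finset.card_eq_zero] at h
    simp [h] at hsum
  · obtain ⟨u, rfl⟩ := Finset.card_eq_one.1 h
    simp only [Finset.sum_singleton] at hsum ⊢
    rw [norm_smul, hnorm u (by simp), mul_pow, Real.norm_eq_abs, sq_abs]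
    nlinarith
  · obtain ⟨u, v, huv, rfl⟩ := Finset.card_eq_two.1 h
    rw [Finset.sum_pair huv] at hsum
    rw [Finset.sum_pair huv, Finset.sum_pair huv, norm_add_sq_real, norm_smul, norm_smul,
      inner_smul_left, inner_smul_right, hnorm u (by simp), hnorm v (by simp), mul_pow, mul_pow,
      Real.norm_eq_abs, Real.norm_eq_abs, sq_abs, sq_abs]
    simp only [conj_trivial]
    have hu := hs u (by simp)
    have hv := hs v (by simp)
    have h' := hpos u (by simp) v (by simp)
    have h1 : 0 ≤ s u * (s v * ⟪u, v⟫_ℝ) := by positivity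
    rcases eq_or_ne (s u) (s v) with heq | hne
    · have : 0 < s v := by linarith
      rw [heq]
      have : 0 < s v * (s v * ⟪u, v⟫_ℝ) := by positivity
      nlinarith
    · have : 0 < (s u - s v) ^ 2 := by
        have := sub_ne_zero.2 hne
        positivity
      nlinarith

lemma inner_sum_smul_le {e e' : Finset R3} {s t : R3 → ℝ} (hs : ∀ v ∈ e, 0 ≤ s v)
    (ht : ∀ v ∈ e', 0 ≤ t v) (hst : ∀ v ∈ e, v ∈ e' → s v * t v = 0)
    (hle : ∀ v ∈ e, ∀ w ∈ e', v ≠ w → ⟪v, w⟫_ℝ ≤ 2) :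
    ⟪∑ v ∈ e, s v • v, ∑ w ∈ e', t w • w⟫_ℝ ≤ 2 * ((∑ v ∈ e, s v) * ∑ w ∈ e', t w) := by
  rw [sum_inner, Finset.sum_mul_sum, Finset.mul_sum]
  refine Finset.sum_le_sum fun v hv => ?_
  rw [inner_sum, Finset.mul_sum]
  refine Finset.sum_le_sum fun w hw => ?_
  rw [inner_smul_left, inner_smul_right, conj_trivial, ← mul_assoc]
  rcases eq_or_ne v w with rfl | hvw
  · simp [hst v hv hw]
  · have := mul_nonneg (hs v hv) (ht w hw)
    nlinarith [hle v hv w hw hvw]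

open scoped Classical in
/-- Two short edges of a configuration do not cross: after the common part of two representations
of the same point is removed, the remaining weights are disjointly supported, and
`two_mul_sum_sq_lt_norm_sq` is incompatible with the bound `⟪v, w⟫ ≤ 2` unless they vanish. -/
lemma cone_inter_cone {e e' : Finset R3} (hcard : e.card ≤ 2) (hcard' : e'.card ≤ 2)
    (hnorm : ∀ v ∈ e, ‖v‖ = 2) (hnorm' : ∀ v ∈ e', ‖v‖ = 2)
    (hpos : ∀ v ∈ e, ∀ w ∈ e, 0 < ⟪v, w⟫_ℝ) (hpos' : ∀ v ∈ e', ∀ w ∈ e', 0 < ⟪v, w⟫_ℝ)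
    (hle : ∀ v ∈ e, ∀ w ∈ e', v ≠ w → ⟪v, w⟫_ℝ ≤ 2) :
    cone e ∩ cone e' = cone (e ∩ e') := by
  refine Set.Subset.antisymm ?_
    (Set.subset_inter (cone_mono Finset.inter_subset_left) (cone_mono Finset.inter_subset_right))
  rintro x ⟨hx, hx'⟩
  obtain ⟨s, hs, hxs⟩ := (mem_cone_iff e x).1 hx
  obtain ⟨t, ht, hxt⟩ := (mem_cone_iff e' x).1 hx'
  set z : R3 := ∑ v ∈ e ∩ e', min (s v) (t v) • v with hz
  let s' : R3 → ℝ := fun v => s v - if v ∈ e' then min (s v) (t v) else 0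
  let t' : R3 → ℝ := fun v => t v - if v ∈ e then min (s v) (t v) else 0
  have hys : x - z = ∑ v ∈ e, s' v • v := by
    simp only [s', sub_smul, ite_smul, zero_smul, Finset.sum_sub_distrib, Finset.sum_ite_mem, hz]
    rw [← hxs]
  have hyt : x - z = ∑ v ∈ e', t' v • v := by
    simp only [t', sub_smul, ite_smul, zero_smul, Finset.sum_sub_distrib, Finset.sum_ite_mem, hz]
    rw [← hxt, Finset.inter_comm]
  have hs' : ∀ v ∈ e, 0 ≤ s' v := by
    intro v hv
    simp only [s']
    split_ifs
    · linarith [min_le_left (s v) (t v)]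
    · simpa using hs v hv
  have ht' : ∀ v ∈ e', 0 ≤ t' v := by
    intro v hv
    simp only [t']
    split_ifs
    · linarith [min_le_right (s v) (t v)]
    · simpa using ht v hv
  have hst : ∀ v ∈ e, v ∈ e' → s' v * t' v = 0 := by
    intro v hv hv'
    simp only [s', t', if_pos hv, if_pos hv']
    rcases min_choice (s v) (t v) with h | h <;> simp [h]
  have hinner := inner_sum_smul_le hs' ht' hst hle
  rw [← hys, ← hyt, real_inner_self_eq_norm_sq] at hinner
  have hS := Finset.sum_nonneg hs'
  have hT := Finset.sum_nonneg ht'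
  have hS0 : ∑ v ∈ e, s' v = 0 := by
    by_contra hne
    have h1 := two_mul_sum_sq_lt_norm_sq hcard hnorm hpos hs' (lt_of_le_of_ne hS (Ne.symm hne))
    rw [← hys] at h1
    have h2 : 2 * (∑ v ∈ e', t' v) ^ 2 ≤ ‖x - z‖ ^ 2 := by
      rcases hT.eq_or_lt with h | h
      · rw [← h]
        simp
      · rw [hyt]
        exact (two_mul_sum_sq_lt_norm_sq hcard' hnorm' hpos' ht' h).le
    nlinarith [sq_nonneg (∑ v ∈ e, s' v - ∑ v ∈ e', t' v)]
  have hxz : x = z := by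
    rw [hS0, zero_mul, mul_zero] at hinner
    have : ‖x - z‖ = 0 := by nlinarith [norm_nonneg (x - z)]
    exact sub_eq_zero.1 (norm_eq_zero.1 this)
  refine (mem_cone_iff _ x).2 ⟨fun v => min (s v) (t v), fun v hv => ?_, hxz⟩
  rw [Finset.mem_inter] at hv
  exact le_min (hs v hv.1) (ht v hv.2)

lemma not_collinear_zero_of_norm_eq_two {x y : R3} (hx : ‖x‖ = 2) (hy : ‖y‖ = 2)
    (hpos : 0 < ⟪x, y⟫_ℝ) (hle : ⟪x, y⟫_ℝ ≤ 2) : ¬ Collinear ℝ ({0, x, y} : Set R3) := by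
  intro h
  obtain ⟨d, hd⟩ := (collinear_iff_of_mem (p₀ := (0 : R3)) (by simp)).1 h
  obtain ⟨r, hr⟩ := hd x (by simp)
  obtain ⟨s, hs⟩ := hd y (by simp)
  simp only [vadd_eq_add, add_zero] at hr hs
  have h1 : r ^ 2 * ‖d‖ ^ 2 = 4 := by
    rw [← sq_abs r, ← Real.norm_eq_abs, ← mul_pow, ← norm_smul, ← hr, hx]; norm_num
  have h2 : s ^ 2 * ‖d‖ ^ 2 = 4 := by
    rw [← sq_abs s, ← Real.norm_eq_abs, ← mul_pow, ← norm_smul, ← hs, hy]; norm_num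
  have h3 : ⟪x, y⟫_ℝ = r * s * ‖d‖ ^ 2 := by
    rw [hr, hs, inner_smul_left, inner_smul_right, conj_trivial, real_inner_self_eq_norm_sq]
    ring
  have h4 : ⟪x, y⟫_ℝ ^ 2 = 16 := by
    rw [h3]
    linear_combination s ^ 2 * ‖d‖ ^ 2 * h1 + 4 * h2
  nlinarith

/-- The edges of length less than `√8` of a configuration of the class form a fan. -/
lemma isFan_EPlus {W : Set R3} (hW : W ∈ ClassV) : IsFan W (EPlus W) := by
  classical
  have hfin : W.Finite := Set.finite_of_encard_eq_coe (k := 12) hW.2.1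
  have hne : W.Nonempty := by
    rw [← Set.encard_ne_zero, hW.2.1]
    norm_num
  have key : ∀ e ∈ EPlus W ∪ {s | ∃ v ∈ W, s = {v}}, e.card ≤ 2 ∧ (∀ v ∈ e, v ∈ W) ∧
      ∀ v ∈ e, ∀ w ∈ e, 0 < ⟪v, w⟫_ℝ := by
    have hself : ∀ v ∈ W, 0 < ⟪v, v⟫_ℝ := fun v hv => by
      rw [real_inner_self_eq_norm_sq, norm_eq_two_of_mem hW hv]
      norm_num
    rintro e (⟨u, hu, v, hv, -, huv, rfl⟩ | ⟨v, hv, rfl⟩)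
    · have hpos := (inner_pos_iff_dist_lt hW hu hv).2 huv
      refine ⟨Finset.card_le_two, by simp [hu, hv], ?_⟩
      simp only [Finset.mem_insert, Finset.mem_singleton, forall_eq_or_imp, forall_eq]
      exact ⟨⟨hself u hu, hpos⟩, real_inner_comm u v ▸ hpos, hself v hv⟩
    · exact ⟨by simp, by simp [hv], by simpa using hself v hv⟩
  refine ⟨?_, hfin, hne, ?_, ?_, ?_⟩
  · rintro e ⟨u, hu, v, hv, huv, -, rfl⟩
    refine ⟨Finset.card_pair ?_, by simp [Set.insert_subset_iff, hu, hv]⟩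
    rintro rfl
    norm_num at huv
  · intro h
    simpa using norm_eq_two_of_mem hW h
  · intro v w h
    obtain ⟨-, hmem, hpos⟩ := key _ (Or.inl h)
    have hv := hmem v (by simp)
    have hw := hmem w (by simp)
    have hvw : v ≠ w := by
      rintro rfl
      obtain ⟨u, -, u', -, huu, -, he⟩ := h
      have h1 : u ∈ ({v, v} : Finset R3) := by rw [he]; simp
      have h2 : u' ∈ ({v, v} : Finset R3) := by rw [he]; simp
      simp only [Finset.mem_insert, Finset.mem_singleton, or_self] at h1 h2
      norm_num [h1, h2] at huu
    exact not_collinear_zero_of_norm_eq_two (norm_eq_two_of_mem hW hv)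
      (norm_eq_two_of_mem hW hw) (hpos v (by simp) w (by simp)) (inner_le_two hW hv hw hvw)
  · intro e he e' he'
    obtain ⟨hc, hm, hp⟩ := key e he
    obtain ⟨hc', hm', hp'⟩ := key e' he'
    exact cone_inter_cone hc hc' (fun v hv => norm_eq_two_of_mem hW (hm v hv))
      (fun v hv => norm_eq_two_of_mem hW (hm' v hv)) hp hp'
      fun v hv w hw => inner_le_two hW (hm v hv) (hm' w hw)

/-! ### Rotations about an axis -/

/-- The cross product `w × x`. -/
def cross (w x : R3) : R3 :=
  !₂[w 1 * x 2 - w 2 * x 1, w 2 * x 0 - w 0 * x 2, w 0 * x 1 - w 1 * x 0]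

/-- The rotation by the angle `θ` about the unit vector `w`, by Rodrigues' formula. -/
def rot (w : R3) (θ : ℝ) (x : R3) : R3 :=
  ⟪x, w⟫_ℝ • w + (Real.cos θ • (x - ⟪x, w⟫_ℝ • w) + Real.sin θ • cross w x)

lemma inner_eq_coord (x y : R3) : ⟪x, y⟫_ℝ = x 0 * y 0 + x 1 * y 1 + x 2 * y 2 := by
  simp [PiLp.inner_apply, Fin.sum_univ_three, mul_comm]

lemma inner_cross_left (w x : R3) : ⟪cross w x, w⟫_ℝ = 0 := by
  simp only [inner_eq_coord]
  simp [cross]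
  ring

lemma inner_cross_right (w x : R3) : ⟪cross w x, x⟫_ℝ = 0 := by
  simp only [inner_eq_coord]
  simp [cross]
  ring

lemma inner_cross_self (w x : R3) :
    ⟪cross w x, cross w x⟫_ℝ = ⟪w, w⟫_ℝ * ⟪x, x⟫_ℝ - ⟪x, w⟫_ℝ ^ 2 := by
  simp only [inner_eq_coord]
  simp [cross]
  ring

/-- The square of the triple product is the Gram determinant. -/
lemma inner_cross_sq (w x y : R3) : ⟪cross w x, y⟫_ℝ ^ 2 =
    ⟪w, w⟫_ℝ * ⟪x, x⟫_ℝ * ⟪y, y⟫_ℝ + 2 * ⟪x, w⟫_ℝ * ⟪x, y⟫_ℝ * ⟪y, w⟫_ℝ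
      - ⟪w, w⟫_ℝ * ⟪x, y⟫_ℝ ^ 2 - ⟪x, x⟫_ℝ * ⟪y, w⟫_ℝ ^ 2 - ⟪y, y⟫_ℝ * ⟪x, w⟫_ℝ ^ 2 := by
  simp only [inner_eq_coord]
  simp [cross]
  ring

lemma cross_sub (w x y : R3) : cross w (x - y) = cross w x - cross w y := by
  ext i
  fin_cases i <;> simp [cross] <;> ring

lemma cross_smul_self (w : R3) (c : ℝ) : cross w (c • w) = 0 := by
  ext i
  fin_cases i <;> simp [cross] <;> ring

lemma rot_sub (w : R3) (θ : ℝ) (x y : R3) : rot w θ (x - y) = rot w θ x - rot w θ y := by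
  simp only [rot, inner_sub_left, cross_sub]
  module

lemma rot_zero_angle (w x : R3) : rot w 0 x = x := by
  simp [rot]

lemma rot_smul_self {w : R3} (hw : ‖w‖ = 1) (θ c : ℝ) : rot w θ (c • w) = c • w := by
  simp [rot, cross_smul_self, inner_smul_left, hw]

lemma norm_rot {w : R3} (hw : ‖w‖ = 1) (θ : ℝ) (x : R3) : ‖rot w θ x‖ = ‖x‖ := by
  have hww : ⟪w, w⟫_ℝ = 1 := by simp [hw]
  have h : ⟪rot w θ x, rot w θ x⟫_ℝ = ⟪x, x⟫_ℝ := by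
    have h1 := inner_cross_left w x
    have h2 := inner_cross_right w x
    have h3 := inner_cross_self w x
    have h4 := real_inner_comm x w
    have h5 := real_inner_comm (cross w x) x
    have h6 := real_inner_comm (cross w x) w
    simp only [rot, inner_add_left, inner_add_right, inner_smul_left, inner_smul_right,
      inner_sub_left, inner_sub_right, conj_trivial, hww, h3, h1, h2, h4, h5, h6]
    linear_combination (⟪x, x⟫_ℝ - ⟪x, w⟫_ℝ ^ 2) * Real.sin_sq_add_cos_sq θ
  rw [real_inner_self_eq_norm_sq, real_inner_self_eq_norm_sq] at h
  exact (sq_eq_sq₀ (norm_nonneg _) (norm_nonneg _)).1 h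

lemma dist_rot {w : R3} (hw : ‖w‖ = 1) (θ : ℝ) (x y : R3) :
    dist (rot w θ x) (rot w θ y) = dist x y := by
  rw [dist_eq_norm, dist_eq_norm, ← rot_sub, norm_rot hw]

lemma continuous_rot (w x : R3) : Continuous fun θ => rot w θ x := by
  unfold rot
  fun_prop

/-- Some rotation about `w` brings `x` into the half plane bounded by the axis that contains `y`. -/
lemma exists_inner_rot_eq {w : R3} (hw : ‖w‖ = 1) (x y : R3) :
    ∃ θ, ⟪rot w θ x, y⟫_ℝ = ⟪x, w⟫_ℝ * ⟪y, w⟫_ℝ +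
      √((⟪x, x⟫_ℝ - ⟪x, w⟫_ℝ ^ 2) * (⟪y, y⟫_ℝ - ⟪y, w⟫_ℝ ^ 2)) := by
  have hww : ⟪w, w⟫_ℝ = 1 := by simp [hw]
  let z : ℂ := ⟨⟪x, y⟫_ℝ - ⟪x, w⟫_ℝ * ⟪y, w⟫_ℝ, ⟪cross w x, y⟫_ℝ⟩
  have hz : ‖z‖ ^ 2 = (⟪x, x⟫_ℝ - ⟪x, w⟫_ℝ ^ 2) * (⟪y, y⟫_ℝ - ⟪y, w⟫_ℝ ^ 2) := by
    rw [← Complex.normSq_eq_norm_sq, Complex.normSq_apply]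
    have := inner_cross_sq w x y
    rw [hww] at this
    simp only [z]
    linear_combination this
  refine ⟨z.arg, ?_⟩
  rw [← hz, Real.sqrt_sq (norm_nonneg z)]
  have h1 : ‖z‖ * Real.cos z.arg = ⟪x, y⟫_ℝ - ⟪x, w⟫_ℝ * ⟪y, w⟫_ℝ := Complex.norm_mul_cos_arg z
  have h2 : ‖z‖ * Real.sin z.arg = ⟪cross w x, y⟫_ℝ := Complex.norm_mul_sin_arg z
  simp only [rot, inner_add_left, inner_smul_left, inner_sub_left, conj_trivial]
  rw [real_inner_comm y w, ← h1, ← h2]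
  linear_combination ‖z‖ * Real.sin_sq_add_cos_sq z.arg

/-! ### Turning one part of a configuration until it approaches the rest -/

/-- A placement on the sphere stays in the class, with the same contacts, if the only distances that
change are between points at distance at least `√8`, and these stay at least `2.6 > 2 * h0`. -/
lemma mem_goodPlacements_of_dist {W : Set R3} (hW : W ∈ ClassV) {p : W → R3}
    (hnorm : ∀ x, ‖p x‖ = 2)
    (hdist : ∀ x y : W, dist (p x) (p y) = dist (x : R3) y ∨
      √8 ≤ dist (x : R3) y ∧ 2.6 ≤ dist (p x) (p y)) :
    p ∈ goodPlacements W := by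
  have h8 : (2.6 : ℝ) < √8 := by
    rw [Real.lt_sqrt] <;> norm_num
  have hinj : Function.Injective p := by
    intro x y hxy
    rcases hdist x y with h | h
    · rw [hxy, dist_self] at h
      exact Subtype.ext (dist_eq_zero.1 h.symm)
    · rw [hxy, dist_self] at h
      norm_num at h
  have hge : ∀ x y : W, x ≠ y → 2 ≤ dist (p x) (p y) := by
    intro x y hxy
    rcases hdist x y with h | h
    · rw [h]
      exact two_le_dist hW x.2 y.2 fun h' => hxy (Subtype.ext h')
    · linarith [h.2]
  refine ⟨hinj, ⟨?_, ?_, ?_, ?_⟩, ?_, ?_⟩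
  · rintro _ ⟨x, rfl⟩ _ ⟨y, rfl⟩ h
    by_contra hne
    exact absurd (hge x y fun h' => hne (h' ▸ rfl)) (not_le.2 h)
  · rw [← Set.image_univ, hinj.encard_image, Set.encard_univ]
    exact hW.2.1
  · rintro _ ⟨x, rfl⟩
    simpa using hnorm x
  · rintro _ ⟨x, rfl⟩ _ ⟨y, rfl⟩
    rcases hdist x y with h | h
    · rw [h]
      rcases hW.2.2.2 x x.2 y y.2 with h' | h'
      · exact Or.inl (by rw [Subtype.ext h'])
      · exact Or.inr h'
    · exact Or.inr (Or.inr (le_trans (by norm_num [h0]) h.2))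
  · intro x y
    rw [Subtype.dist_eq]
    rcases hdist x y with h | h
    · rw [h]
    · constructor <;> intro h' <;> linarith [h.1, h.2]
  · intro x y hxy
    rw [Subtype.dist_eq]
    rcases hdist x y with h | h
    · rwa [← h]
    · norm_num [h0] at hxy
      linarith [h.2]

/-- If no pair in `A × B` is shorter than `√8`, and every point outside `A` and `B` lies on the axis
`w`, then `A` can be turned about the axis until a new pair shorter than `√8` appears. The condition
on `a` and `b` says that their latitudes with respect to the axis are close enough. -/
lemma exists_joinedIn_of_separated {W : Set R3} (hW : W ∈ ClassV) {w : R3} (hw : ‖w‖ = 1)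
    {A B : Set W} (hcover : ∀ x : W, x ∈ A ∨ x ∈ B ∨ (x : R3) = (2 : ℝ) • w)
    (hAB : ∀ x ∈ A, ∀ y ∈ B, √8 ≤ dist (x : R3) y) {a b : W} (ha : a ∈ A) (hb : b ∈ B)
    (ha0 : 0 ≤ ⟪(a : R3), w⟫_ℝ) (ha1 : ⟪(a : R3), w⟫_ℝ ≤ 1)
    (hb0 : 0 ≤ ⟪(b : R3), w⟫_ℝ) (hb1 : ⟪(b : R3), w⟫_ℝ ≤ 1) :
    ∃ p : W → R3, JoinedIn (goodPlacements W) (fun x : W => (x : R3)) p ∧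
      (∀ x y : W, dist (x : R3) y < √8 → dist (p x) (p y) < √8) ∧
      ∃ x y : W, √8 ≤ dist (x : R3) y ∧ dist (p x) (p y) < √8 := by
  classical
  have h8 : (2.6 : ℝ) < √8 := by
    rw [Real.lt_sqrt] <;> norm_num
  have : Finite W := (Set.finite_of_encard_eq_coe (k := 12) hW.2.1).to_subtype
  have hnorm : ∀ x : W, ‖(x : R3)‖ = 2 := fun x => norm_eq_two_of_mem hW x.2
  obtain ⟨θ, hθ⟩ := exists_inner_rot_eq hw (a : R3) b
  let r : ℝ → W → R3 := fun t x => rot w (t * θ) x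
  have hr : ∀ x, Continuous fun t => r t x := fun x =>
    (continuous_rot w x).comp (continuous_id.mul continuous_const)
  have hcont : ∀ x y : W, Continuous fun t => dist (r t x) (y : R3) := fun x y =>
    (hr x).dist continuous_const
  -- The times at which `A` comes within distance `2.6` of `B`.
  let T : Set ℝ := Set.Icc 0 1 ∩ ⋃ x ∈ A, ⋃ y ∈ B, {t | dist (r t x) (y : R3) ≤ 2.6}
  have hT : IsCompact T := by
    refine isCompact_Icc.inter_right ?_
    refine (Set.toFinite A).isClosed_biUnion fun x _ => ?_
    exact (Set.toFinite B).isClosed_biUnion fun y _ => isClosed_le (hcont x y) continuous_const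
  have hTmem : ∀ t, t ∈ T ↔ t ∈ Set.Icc (0 : ℝ) 1 ∧
      ∃ x ∈ A, ∃ y ∈ B, dist (r t x) (y : R3) ≤ 2.6 := by
    intro t
    simp [T]
  have h1T : (1 : ℝ) ∈ T := by
    refine (hTmem 1).2 ⟨by simp, a, ha, b, hb, ?_⟩
    -- Each point has distance at least `√3` from the axis.
    have hsqrt : 3 ≤ √((⟪(a : R3), a⟫_ℝ - ⟪(a : R3), w⟫_ℝ ^ 2) *
        (⟪(b : R3), b⟫_ℝ - ⟪(b : R3), w⟫_ℝ ^ 2)) := by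
      apply Real.le_sqrt_of_sq_le
      rw [real_inner_self_eq_norm_sq, real_inner_self_eq_norm_sq, hnorm, hnorm]
      have h1 : 3 ≤ (2 : ℝ) ^ 2 - ⟪(a : R3), w⟫_ℝ ^ 2 := by nlinarith
      have h2 : 3 ≤ (2 : ℝ) ^ 2 - ⟪(b : R3), w⟫_ℝ ^ 2 := by nlinarith
      nlinarith
    have h3 : 3 ≤ ⟪r 1 a, (b : R3)⟫_ℝ := by
      simp only [r, one_mul]
      rw [hθ]
      nlinarith [mul_nonneg ha0 hb0]
    rw [inner_eq_of_norm_eq_two (by rw [norm_rot hw, hnorm]) (hnorm b)] at h3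
    exact abs_le_of_sq_le_sq' (by norm_num; linarith) (by norm_num) |>.2
  obtain ⟨t₀, ht₀T, hmin⟩ := hT.exists_isLeast ⟨1, h1T⟩
  obtain ⟨ht₀, x₀, hx₀, y₀, hy₀, hxy₀⟩ := (hTmem t₀).1 ht₀T
  have hfar : ∀ t ∈ Set.Icc 0 t₀, ∀ x ∈ A, ∀ y ∈ B, 2.6 ≤ dist (r t x) (y : R3) := by
    intro t ht x hx y hy
    by_contra! hlt
    -- Some time `s ≤ t` realizes the distance `2.6` exactly.
    have hstart : (2.6 : ℝ) ≤ dist (r 0 x) (y : R3) := by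
      simp only [r, zero_mul, rot_zero_angle]
      linarith [hAB x hx y hy]
    obtain ⟨s, hs, hs'⟩ := intermediate_value_Icc' ht.1 (hcont x y).continuousOn ⟨hlt.le, hstart⟩
    have hsT : s ∈ T := (hTmem s).2
      ⟨⟨hs.1, hs.2.trans (ht.2.trans ht₀.2)⟩, x, hx, y, hy, le_of_eq hs'⟩
    -- Minimality of `t₀` forces `s = t = t₀`.
    have hst : s = t := le_antisymm hs.2 (ht.2.trans (hmin hsT))
    rw [hst] at hs'
    exact hlt.ne hs'
  let p : ℝ → W → R3 := fun t x => if x ∈ A then r t x else x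
  have hpA : ∀ t, ∀ x ∈ A, p t x = r t x := fun t x hx => if_pos hx
  have hpB : ∀ t, ∀ x ∉ A, p t x = x := fun t x hx => if_neg hx
  have hmixed : ∀ t ∈ Set.Icc 0 t₀, ∀ x ∈ A, ∀ y ∉ A, dist (r t x) (y : R3) = dist (x : R3) y ∨
      √8 ≤ dist (x : R3) y ∧ 2.6 ≤ dist (r t x) (y : R3) := by
    intro t ht x hx y hy
    rcases hcover y with h | h | h
    · exact absurd h hy
    · exact Or.inr ⟨hAB x hx y h, hfar t ht x hx y h⟩
    · left
      rw [h]
      nth_rewrite 1 [← rot_smul_self hw (t * θ) 2]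
      exact dist_rot hw _ _ _
  have hdist : ∀ t ∈ Set.Icc 0 t₀, ∀ x y : W, dist (p t x) (p t y) = dist (x : R3) y ∨
      √8 ≤ dist (x : R3) y ∧ 2.6 ≤ dist (p t x) (p t y) := by
    intro t ht x y
    by_cases hx : x ∈ A <;> by_cases hy : y ∈ A
    · rw [hpA t x hx, hpA t y hy]
      exact Or.inl (dist_rot hw _ _ _)
    · rw [hpA t x hx, hpB t y hy]
      exact hmixed t ht x hx y hy
    · rw [hpB t x hx, hpA t y hy, dist_comm (x : R3), dist_comm (x : R3)]
      exact hmixed t ht y hy x hx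
    · rw [hpB t x hx, hpB t y hy]
      exact Or.inl rfl
  have hgood : ∀ t ∈ Set.Icc 0 t₀, p t ∈ goodPlacements W := by
    intro t ht
    refine mem_goodPlacements_of_dist hW (fun x => ?_) (hdist t ht)
    by_cases hx : x ∈ A
    · rw [hpA t x hx, norm_rot hw, hnorm]
    · rw [hpB t x hx, hnorm]
  have ht₀' : t₀ ∈ Set.Icc 0 t₀ := ⟨ht₀.1, le_rfl⟩
  have hy₀A : y₀ ∉ A := by
    intro h
    have := hAB y₀ h y₀ hy₀
    rw [dist_self] at this
    linarith
  refine ⟨p t₀, ?_, ?_, x₀, y₀, hAB x₀ hx₀ y₀ hy₀, ?_⟩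
  · refine JoinedIn.ofLine (f := fun s => p (s * t₀)) ?_ ?_ (by simp) ?_
    · refine Continuous.continuousOn (continuous_pi fun x => ?_)
      by_cases hx : x ∈ A
      · simp only [p, if_pos hx]
        exact (hr x).comp (continuous_id.mul continuous_const)
      · simp only [p, if_neg hx]
        exact continuous_const
    · funext x
      simp only [p, r, zero_mul, rot_zero_angle, ite_self]
    · rintro _ ⟨s, hs, rfl⟩
      exact hgood _ ⟨mul_nonneg hs.1 ht₀.1, mul_le_of_le_one_left ht₀.1 hs.2⟩
  · intro x y hxy
    rcases hdist t₀ ht₀' x y with h | h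
    · rwa [h]
    · exact absurd h.1 (not_le.2 hxy)
  · rw [hpA t₀ x₀ hx₀, hpB t₀ y₀ hy₀A]
    linarith

/-! ### Separations of graphs that are not biconnected -/

lemma exists_adj_of_connected {α : Type*} {G : SimpleGraph α} (hG : G.Connected) {S : Set α} {v : α}
    (hS : S.Nonempty) (hv : v ∉ S) (hsep : ∀ x ∈ S, ∀ y ∉ S, y ≠ v → ¬ G.Adj x y) :
    ∃ a ∈ S, G.Adj a v := by
  obtain ⟨u, hu⟩ := hS
  obtain ⟨p⟩ := hG.preconnected u v
  obtain ⟨d, -, h1, h2⟩ := p.exists_boundary_dart S hu hv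
  have hd : d.snd = v := by
    by_contra h
    exact hsep _ h1 _ h2 h d.adj
  exact ⟨d.fst, h1, hd ▸ d.adj⟩

/-- A graph that is not biconnected falls into two parts without edges between them, either after no
deletion at all or after the deletion of a vertex `v` with neighbors in both parts. -/
lemma exists_separation {α : Type*} [Nonempty α] {G : SimpleGraph α} (hG : ¬ IsBiconnected G) :
    ∃ A B : Set α, (∀ x ∈ A, ∀ y ∈ B, x ≠ y ∧ ¬ G.Adj x y) ∧
      (((∀ x, x ∈ A ∨ x ∈ B) ∧ A.Nonempty ∧ B.Nonempty) ∨
        ∃ v, (∀ x, x ∈ A ∨ x ∈ B ∨ x = v) ∧ (∃ a ∈ A, G.Adj a v) ∧ ∃ b ∈ B, G.Adj b v) := by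
  by_cases hconn : G.Connected
  · have hart : ∃ v, IsArticulation G v := by
      by_contra! h
      exact hG ⟨hconn, h⟩
    obtain ⟨v, hv⟩ := hart
    have hone : 1 ≤ ENat.card G.ConnectedComponent :=
      (ENat.one_le_card_iff_nonempty _).2 ⟨G.connectedComponentMk v⟩
    replace hv := ENat.one_lt_card_iff_nontrivial _ |>.1 (lt_of_le_of_lt hone hv)
    obtain ⟨c, c', hcc⟩ := hv
    obtain ⟨u, rfl⟩ := c.exists_rep
    obtain ⟨u', rfl⟩ := c'.exists_rep
    set H := G.induce ({v}ᶜ : Set α)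
    -- `A` is the component of `u` after the deletion of `v`, and `B` is the rest.
    let A : Set α := {x | ∃ h : x ≠ v, H.Reachable u ⟨x, h⟩}
    let B : Set α := {x | x ≠ v ∧ x ∉ A}
    have hsep : ∀ x ∈ A, ∀ y, y ∉ A → y ≠ v → ¬ G.Adj x y := by
      rintro x ⟨hx, hux⟩ y hy hyv hadj
      have : H.Adj ⟨x, hx⟩ ⟨y, hyv⟩ := hadj
      exact hy ⟨hyv, hux.trans this.reachable⟩
    have hvA : v ∉ A := fun h => h.1 rfl
    have huA : (u : α) ∈ A := ⟨u.2, SimpleGraph.Reachable.refl _⟩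
    have huB : (u' : α) ∈ B := ⟨u'.2, fun h => hcc (SimpleGraph.ConnectedComponent.sound h.2)⟩
    refine ⟨A, B, fun x hx y hy => ⟨?_, hsep x hx y hy.2 hy.1⟩, Or.inr ⟨v, fun x => ?_, ?_, ?_⟩⟩
    · rintro rfl
      exact hy.2 hx
    · by_cases hxA : x ∈ A
      · exact Or.inl hxA
      · by_cases hxv : x = v
        · exact Or.inr (Or.inr hxv)
        · exact Or.inr (Or.inl ⟨hxv, hxA⟩)
    · exact exists_adj_of_connected hconn ⟨u, huA⟩ hvA hsep
    · refine exists_adj_of_connected hconn ⟨u', huB⟩ (fun h => h.1 rfl) fun x hx y hy hyv hadj => ?_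
      have hyA : y ∈ A := by
        by_contra h
        exact hy ⟨hyv, h⟩
      exact hsep y hyA x hx.2 hx.1 hadj.symm
  · have hpre : ∃ u v, ¬ G.Reachable u v := by
      by_contra! h
      exact hconn ⟨h⟩
    obtain ⟨u, v, huv⟩ := hpre
    refine ⟨{x | G.Reachable u x}, {x | ¬ G.Reachable u x}, fun x hx y hy => ⟨?_, ?_⟩,
      Or.inl ⟨fun x => em _, ⟨u, SimpleGraph.Reachable.refl _⟩, ⟨v, huv⟩⟩⟩
    · rintro rfl
      exact hy hx
    · exact fun hadj => hy (SimpleGraph.Reachable.trans hx hadj.reachable)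

lemma exists_unit_orthogonal (a b : R3) : ∃ w : R3, ‖w‖ = 1 ∧ ⟪a, w⟫_ℝ = 0 ∧ ⟪b, w⟫_ℝ = 0 := by
  classical
  have hne : Submodule.span ℝ ({a, b} : Set R3) ≠ ⊤ := by
    intro h
    have h1 := finrank_span_finset_le_card (R := ℝ) ({a, b} : Finset R3)
    rw [Finset.coe_insert, Finset.coe_singleton, Set.finrank, h, finrank_top,
      finrank_euclideanSpace_fin] at h1
    have h2 : ({a, b} : Finset R3).card ≤ 2 := Finset.card_le_two
    omega
  obtain ⟨w, hw, hw0⟩ :=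
    Submodule.exists_mem_ne_zero_of_ne_bot (mt Submodule.orthogonal_eq_bot_iff.1 hne)
  rw [Submodule.mem_orthogonal] at hw
  refine ⟨(‖w‖)⁻¹ • w, norm_smul_inv_norm hw0, ?_, ?_⟩
  · rw [inner_smul_right, hw a (Submodule.subset_span (by simp)), mul_zero]
  · rw [inner_smul_right, hw b (Submodule.subset_span (by simp)), mul_zero]

/-- A configuration whose graph of short edges is not biconnected admits a deformation that keeps
all short edges and gains at least one. -/
lemma exists_joinedIn_of_not_biconnected {W : Set R3} (hW : W ∈ ClassV)
    (hbi : ¬ IsBiconnected (graphOf W (EPlus W))) :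
    ∃ p : W → R3, JoinedIn (goodPlacements W) (fun x : W => (x : R3)) p ∧
      (∀ x y : W, dist (x : R3) y < √8 → dist (p x) (p y) < √8) ∧
      ∃ x y : W, √8 ≤ dist (x : R3) y ∧ dist (p x) (p y) < √8 := by
  have : Nonempty W := (isFan_EPlus hW).nonempty.to_subtype
  obtain ⟨A, B, hAB, h⟩ := exists_separation hbi
  have hfar : ∀ x ∈ A, ∀ y ∈ B, √8 ≤ dist (x : R3) y := by
    intro x hx y hy
    by_contra! hlt
    exact (hAB x hx y hy).2 ((graphOf_EPlus_adj_iff hW x y).2 ⟨(hAB x hx y hy).1, hlt⟩)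
  rcases h with ⟨hcover, ⟨a, ha⟩, ⟨b, hb⟩⟩ | ⟨v, hcover, ⟨a, ha, hav⟩, ⟨b, hb, hbv⟩⟩
  · obtain ⟨w, hw, haw, hbw⟩ := exists_unit_orthogonal (a : R3) b
    refine exists_joinedIn_of_separated hW hw (fun x => ?_) hfar ha hb haw.ge ?_ hbw.ge ?_
    · exact (hcover x).imp_right Or.inl
    · linarith
    · linarith
  · have hv : ‖(v : R3)‖ = 2 := norm_eq_two_of_mem hW v.2
    have hbound : ∀ x : W, (graphOf W (EPlus W)).Adj x v →
        0 ≤ ⟪(x : R3), (2⁻¹ : ℝ) • (v : R3)⟫_ℝ ∧ ⟪(x : R3), (2⁻¹ : ℝ) • (v : R3)⟫_ℝ ≤ 1 := by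
      intro x hx
      have hx' := (graphOf_EPlus_adj_iff hW x v).1 hx
      have h1 := (inner_pos_iff_dist_lt hW x.2 v.2).2 hx'.2
      have h2 := inner_le_two hW x.2 v.2 fun h => hx'.1 (Subtype.ext h)
      rw [inner_smul_right]
      constructor <;> linarith
    refine exists_joinedIn_of_separated hW (w := (2⁻¹ : ℝ) • (v : R3)) ?_ (fun x => ?_) hfar ha hb
      (hbound a hav).1 (hbound a hav).2 (hbound b hbv).1 (hbound b hbv).2
    · rw [norm_smul, hv]
      norm_num
    · refine (hcover x).imp_right (Or.imp_right fun h => ?_)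
      rw [h, smul_smul]
      norm_num

/-! ### Placements with the largest number of short edges -/

/-- The ordered pairs of indices placed at distance less than `√8`. -/
def shortPairs {ι : Type*} (q : ι → R3) : Set (ι × ι) :=
  {e | dist (q e.1) (q e.2) < √8}

lemma self_mem_goodPlacements {V : Set R3} (hV : V ∈ ClassV) :
    (fun v : V => (v : R3)) ∈ goodPlacements V :=
  ⟨Subtype.val_injective, by rwa [Subtype.range_coe], fun u v => by rw [Subtype.dist_eq],
    fun u v h => by rwa [Subtype.dist_eq]⟩

lemma comp_mem_goodPlacements {V : Set R3} {q : V → R3} (hq : q ∈ goodPlacements V)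
    {p : Set.range q → R3} (hp : p ∈ goodPlacements (Set.range q)) :
    p ∘ Set.rangeFactorization q ∈ goodPlacements V := by
  obtain ⟨h1, h2, h3, h4⟩ := hp
  refine ⟨h1.comp fun x y h => hq.1 (congrArg Subtype.val h), ?_, fun u v => ?_, fun u v h => ?_⟩
  · rwa [Set.rangeFactorization_surjective.range_comp]
  · exact (h3 _ _).trans (hq.2.2.1 u v)
  · have := h4 (Set.rangeFactorization q u) (Set.rangeFactorization q v) h
    rw [Subtype.dist_eq] at this
    exact hq.2.2.2 u v this

/-- A placement that cannot gain short edges by further deformation has a biconnected graph. -/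
lemma exists_placement_biconnected {V : Set R3} (hV : V ∈ ClassV) :
    ∃ q : V → R3, JoinedIn (goodPlacements V) (fun v : V => (v : R3)) q ∧
      IsBiconnected (graphOf (Set.range q) (EPlus (Set.range q))) := by
  have : Finite V := (Set.finite_of_encard_eq_coe (k := 12) hV.2.1).to_subtype
  let N : (V → R3) → ℕ := fun q => (shortPairs q).ncard
  let J : Set (V → R3) := {q | JoinedIn (goodPlacements V) (fun v : V => (v : R3)) q}
  have hJ : J.Nonempty := ⟨_, JoinedIn.refl (self_mem_goodPlacements hV)⟩
  have hfin : (N '' J).Finite := by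
    refine (Set.finite_Iic (Nat.card (V × V))).subset ?_
    rintro _ ⟨q, -, rfl⟩
    exact Set.ncard_le_card _
  obtain ⟨q, hq, hmax⟩ := Set.exists_max_image (N '' J) id hfin (hJ.image N)
  obtain ⟨q, hqJ, rfl⟩ := hq
  refine ⟨q, hqJ, ?_⟩
  by_contra hbi
  have hqg : q ∈ goodPlacements V := hqJ.target_mem
  obtain ⟨p, hp, hmono, x, y, hxy, hxy'⟩ := exists_joinedIn_of_not_biconnected hqg.2.1 hbi
  have hcomp : p ∘ Set.rangeFactorization q ∈ J := by
    refine JoinedIn.trans hqJ ?_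
    obtain ⟨γ, hγ⟩ := hp
    refine ⟨γ.map (f := fun r : Set.range q → R3 => r ∘ Set.rangeFactorization q)
      (continuous_pi fun v => continuous_apply _), fun t => ?_⟩
    exact comp_mem_goodPlacements hqg (hγ t)
  have hlt : N q < N (p ∘ Set.rangeFactorization q) := by
    refine Set.ncard_lt_ncard ⟨fun e he => hmono _ _ he, fun hsub => ?_⟩ (Set.toFinite _)
    obtain ⟨u, rfl⟩ := Set.rangeFactorization_surjective x
    obtain ⟨v, rfl⟩ := Set.rangeFactorization_surjective y
    have hmem : (u, v) ∈ shortPairs (p ∘ Set.rangeFactorization q) := hxy'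
    exact absurd (hsub hmem) (not_lt.2 hxy)
  exact absurd (hmax _ ⟨_, hcomp, rfl⟩) (not_le.2 hlt)

end KissingTwelve

end

theorem mainTheorem10 (V : Set KissingTwelve.R3) (hV : V ∈ KissingTwelve.ClassV) :
    ∃ V' ∈ KissingTwelve.ClassV', ∃ φ : V' ≃ V,
      (∀ u v : V',
        (KissingTwelve.graphOf V' (KissingTwelve.E2 V')).Adj u v ↔
          (KissingTwelve.graphOf V (KissingTwelve.E2 V)).Adj (φ u) (φ v)) ∧
      JoinedIn (KissingTwelve.goodPlacements V)
        (fun v : V => (v : KissingTwelve.R3))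
        (fun v : V => (φ.symm v : KissingTwelve.R3)) := by
  obtain ⟨q, hq, hbi⟩ := KissingTwelve.exists_placement_biconnected hV
  obtain ⟨hinj, hW, hcontact, -⟩ := hq.target_mem
  refine ⟨Set.range q, ⟨hW, KissingTwelve.isFan_EPlus hW, hbi⟩, (Equiv.ofInjective q hinj).symm,
    fun u v => ?_, hq⟩
  obtain ⟨x, rfl⟩ := (Equiv.ofInjective q hinj).surjective u
  obtain ⟨y, rfl⟩ := (Equiv.ofInjective q hinj).surjective v
  rw [KissingTwelve.graphOf_E2_adj_iff, KissingTwelve.graphOf_E2_adj_iff,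
    Equiv.symm_apply_apply, Equiv.symm_apply_apply]
  exact hcontact x y
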